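/- **Comparison principle on a junction.** Let $N\ge 1$, let $e_1,\dots,e_N\in\mathbb R^2$ be distinct unit vectors, and put $J_i=[0,+\infty)\,e_i$, $J_i^*=J_i\setminus\{0\}$, $J=\bigcup_{i=1}^N J_i$ and, for $T>0$, $J_T=(0,T)\times J$. Let $u_0\colon J\to\mathbb R$ be Lipschitz continuous, and let $L_1,\dots,L_N\in C^2(\mathbb R)$ satisfy $L_i''\ge\gamma$ on $\mathbb R$ for all $i$, for some constant $\gamma>0$. Set $$H_i(p)=\sup_{q\in\mathbb R}\,(pq-L_i(q)),\qquad H_i^-(p)=\sup_{q\le 0}\,(pq-L_i(q)),$$ and consider the Hamilton-Jacobi equation $$u^i_t+H_i(u^i_x)=0\ \text{ on }(0,T)\times J_i^*\ (i=1,\dots,N),\qquad u_t+\max_{i=1,\dots,N}H_i^-(u^i_x)=0\ \text{ on }(0,T)\times\{0\},\tag{1}$$ with initial condition $$u(0,x)=u_0(x),\qquad x\in J.\tag{2}$$ Let $C^1_*(J_T)$ be the set of continuous functions $\phi\colon J_T\to\mathbb R$ such that, for each $i$, $(t,r)\mapsto\phi(t,re_i)$ is of class $C^1$ on $(0,T)\times[0,+\infty)$;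 $\phi_t$ denotes the time derivative, and $\phi^i_x(t,re_i)$ the derivative of $r\mapsto\phi(t,re_i)$ (one-sided at $r=0$). A function $u\colon[0,T)\times J\to\mathbb R$ is a *sub-solution* (resp. *super-solution*) of (1)-(2) on $J_T$ if it is upper (resp. lower) semi-continuous on $[0,T)\times J$, if $u(0,\cdot)\le u_0$ (resp. $u(0,\cdot)\ge u_0$) on $J$, and if, for every $P=(t,x)\in J_T$ and every $\phi\in C^1_*(J_T)$ such that $u(P)=\phi(P)$ and $u\le\phi$ (resp. $u\ge\phi$) in a neighbourhood of $P$ in $J_T$, one has - $\phi_t(t,x)+H_i(\phi^i_x(t,x))\le 0$ (resp. $\ge 0$) if $x\in J_i^*$; - $\phi_t(t,0)+\max_{i=1,\dots,N}H_i^-(\phi^i_x(t,0))\le 0$ (resp. $\ge 0$) if $x=0$. Let $u$ be a sub-solution and $v$ a super-solution of (1)-(2) on $J_T$, and suppose that there is a constant $C_T>0$ such that, for all $(t,x)\in J_T$, $$u(t,x)\le C_T(1+|x|)\qquad\text{and}\qquad v(t,x)\ge -C_T(1+|x|).$$ Then $u\le v$ on $J_T$. -/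

import Mathlib

namespace HJJunction

open Set Filter Topology

noncomputable section

/-- The Euclidean plane in which the junction is embedded. -/
abbrev Plane : Type := EuclideanSpace ℝ (Fin 2)

/-- The branch `J_i = [0, ∞) · e_i`. -/
def branch {N : ℕ} (e : Fin N → Plane) (i : Fin N) : Set Plane :=
  (fun r : ℝ => r • e i) '' Ici 0

/-- The junction `J`, the union of the branches `J_i`. -/
def junction {N : ℕ} (e : Fin N → Plane) : Set Plane :=
  ⋃ i, branch e i

/-- The open time-space domain `J_T = (0,T) × J`. -/
def domainT {N : ℕ} (e : Fin N → Plane) (T : ℝ) : Set (ℝ × Plane) :=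
  Ioo 0 T ×ˢ junction e

/-- The time-space domain `[0,T) × J`, initial time included. -/
def domainT0 {N : ℕ} (e : Fin N → Plane) (T : ℝ) : Set (ℝ × Plane) :=
  Ico 0 T ×ˢ junction e

/-- The Hamiltonian `H_i(p) = sup_{q ∈ ℝ} (p q - L_i(q))` of a Lagrangian `L_i`. -/
def hamiltonian (L : ℝ → ℝ) (p : ℝ) : ℝ :=
  ⨆ q : ℝ, (p * q - L q)

/-- The Hamiltonian `H_i^-(p) = sup_{q ≤ 0} (p q - L_i(q))`. -/
def hamiltonianNeg (L : ℝ → ℝ) (p : ℝ) : ℝ :=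
  ⨆ q : Iic (0 : ℝ), (p * (q : ℝ) - L (q : ℝ))

/-- `φ ∈ C¹_*(J_T)`: `φ` is continuous on `J_T`, and on each branch, in the coordinates `(t, r)`
of the point `(t, r e_i)`, it is of class `C¹` on `(0,T) × [0,∞)`, up to the junction point. -/
structure IsTestFunction {N : ℕ} (e : Fin N → Plane) (T : ℝ) (φ : ℝ × Plane → ℝ) : Prop where
  continuousOn : ContinuousOn φ (domainT e T)
  contDiffOn_branch : ∀ i : Fin N,
    ContDiffOn ℝ 1 (fun z : ℝ × ℝ => φ (z.1, z.2 • e i)) (Ioo 0 T ×ˢ Ici 0)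

/-- The time derivative `φ_t(t,x)`. -/
def timeDeriv (φ : ℝ × Plane → ℝ) (t : ℝ) (x : Plane) : ℝ :=
  deriv (fun s : ℝ => φ (s, x)) t

/-- The space derivative `φ^i_x` at the point `(t, r e_i)`, `r ≥ 0`, along the branch `J_i`;
it is one-sided at the junction point `r = 0`. -/
def branchDeriv {N : ℕ} (e : Fin N → Plane) (φ : ℝ × Plane → ℝ) (i : Fin N) (t r : ℝ) : ℝ :=
  derivWithin (fun ρ : ℝ => φ (t, ρ • e i)) (Ici 0) r

/-- The left-hand side `φ_t + H_i(φ^i_x)` of the equation at `(t, r e_i)`, for `r > 0`. -/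
def branchOperator {N : ℕ} (e : Fin N → Plane) (L : Fin N → ℝ → ℝ) (φ : ℝ × Plane → ℝ)
    (i : Fin N) (t r : ℝ) : ℝ :=
  timeDeriv φ t (r • e i) + hamiltonian (L i) (branchDeriv e φ i t r)

/-- The left-hand side `φ_t + max_i H_i^-(φ^i_x)` of the junction condition at `(t, 0)`. -/
def junctionOperator {N : ℕ} (e : Fin N → Plane) (L : Fin N → ℝ → ℝ) (φ : ℝ × Plane → ℝ)
    (t : ℝ) : ℝ :=
  timeDeriv φ t 0 + ⨆ i : Fin N, hamiltonianNeg (L i) (branchDeriv e φ i t 0)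

/-- `φ` touches `u` from above at `P`: `u ≤ φ` in a ball of `J_T` around `P`, `u = φ` at `P`. -/
def TouchesFromAbove {N : ℕ} (e : Fin N → Plane) (T : ℝ) (u φ : ℝ × Plane → ℝ)
    (P : ℝ × Plane) : Prop :=
  (∀ᶠ Q in 𝓝[domainT e T] P, u Q ≤ φ Q) ∧ u P = φ P

/-- `φ` touches `u` from below at `P`: `φ ≤ u` in a ball of `J_T` around `P`, `u = φ` at `P`. -/
def TouchesFromBelow {N : ℕ} (e : Fin N → Plane) (T : ℝ) (u φ : ℝ × Plane → ℝ)
    (P : ℝ × Plane) : Prop :=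
  (∀ᶠ Q in 𝓝[domainT e T] P, φ Q ≤ u Q) ∧ u P = φ P

/-- `u : [0,T) × J → ℝ` is a viscosity sub-solution on `J_T` of the Hamilton-Jacobi equation
`u_t + H(x, u_x) = 0`. The values of `u` outside `[0,T) × J` are irrelevant. -/
structure IsSubsolution {N : ℕ} (e : Fin N → Plane) (L : Fin N → ℝ → ℝ) (T : ℝ)
    (u : ℝ × Plane → ℝ) : Prop where
  upperSemicontinuousOn : UpperSemicontinuousOn u (domainT0 e T)
  branch_le : ∀ φ : ℝ × Plane → ℝ, IsTestFunction e T φ →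
    ∀ t ∈ Ioo (0 : ℝ) T, ∀ i : Fin N, ∀ r : ℝ, 0 < r →
      TouchesFromAbove e T u φ (t, r • e i) → branchOperator e L φ i t r ≤ 0
  junction_le : ∀ φ : ℝ × Plane → ℝ, IsTestFunction e T φ →
    ∀ t ∈ Ioo (0 : ℝ) T,
      TouchesFromAbove e T u φ (t, 0) → junctionOperator e L φ t ≤ 0

/-- `v : [0,T) × J → ℝ` is a viscosity super-solution on `J_T` of the Hamilton-Jacobi equation
`v_t + H(x, v_x) = 0`. The values of `v` outside `[0,T) × J` are irrelevant. -/
structure IsSupersolution {N : ℕ} (e : Fin N → Plane) (L : Fin N → ℝ → ℝ) (T : ℝ)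
    (v : ℝ × Plane → ℝ) : Prop where
  lowerSemicontinuousOn : LowerSemicontinuousOn v (domainT0 e T)
  branch_ge : ∀ φ : ℝ × Plane → ℝ, IsTestFunction e T φ →
    ∀ t ∈ Ioo (0 : ℝ) T, ∀ i : Fin N, ∀ r : ℝ, 0 < r →
      TouchesFromBelow e T v φ (t, r • e i) → 0 ≤ branchOperator e L φ i t r
  junction_ge : ∀ φ : ℝ × Plane → ℝ, IsTestFunction e T φ →
    ∀ t ∈ Ioo (0 : ℝ) T,
      TouchesFromBelow e T v φ (t, 0) → 0 ≤ junctionOperator e L φ t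

/-- Sub-solution of the Cauchy problem: moreover `u(0,·) ≤ u₀` on `J`. -/
structure IsCauchySubsolution {N : ℕ} (e : Fin N → Plane) (L : Fin N → ℝ → ℝ) (T : ℝ)
    (u₀ : Plane → ℝ) (u : ℝ × Plane → ℝ) : Prop extends IsSubsolution e L T u where
  initial_le : ∀ x ∈ junction e, u (0, x) ≤ u₀ x

/-- Super-solution of the Cauchy problem: moreover `v(0,·) ≥ u₀` on `J`. -/
structure IsCauchySupersolution {N : ℕ} (e : Fin N → Plane) (L : Fin N → ℝ → ℝ) (T : ℝ)
    (u₀ : Plane → ℝ) (v : ℝ × Plane → ℝ) : Prop extends IsSupersolution e L T v where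
  initial_ge : ∀ x ∈ junction e, u₀ x ≤ v (0, x)

end

end HJJunction

/-! The argument is control-theoretic on the side of `u` and viscous on the side of `v`. A
sub-solution is suboptimal: along a trajectory moving with constant velocity `q` inside one branch,
`u` grows by at most the running cost `h * L i q` (`IsSubsolution.le_add`). This holds because
`H_i(p) ≥ p q - L_i(q)` for every `q`, and `H_i^-(p) ≥ p q - L_i(q)` for `q ≤ 0`, so a barrier
concentrated around the trajectory is a strict super-solution. Afterwards only this integral
inequality is needed for `u`; it survives taking minima with suitable affine functions, and
subtracting `η t` makes it strict.

Let `w` be such a strict modification, lying below `v` at time `0` and far from the junction point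
(`IsSupersolution.le_of_suboptimal`). If `w - v` is positive somewhere, double the time variable
only, keeping a common space point. A maximum cannot sit at the junction point
(`IsSupersolution.not_max_at_junction`): on each branch, run a trajectory that reaches the junction
point at the maximal time; suboptimality of `w` along it gives a lower bound for `v` that is `C¹` on
each branch. Strict convexity allows the incoming velocities to be chosen so that the slopes of this
test function keep all `H_j^-` strictly below the value that the junction condition for `v`
requires.

All maxima are therefore interior to branches. Doubling the space variable with a large penalty
keeps them interior, and the usual argument on the line finishes the proof
(`IsSupersolution.not_max_in_branch`). -/

namespace HJJunction

open Set Filter Topology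

/-! ### Convex duality for the Lagrangians, and penalization on compact sets. -/

section Lagrangian

variable {L : ℝ → ℝ} {γ : ℝ}

/-- Subtracting `γ / 2 * (x - a) ^ 2` leaves a convex function, which lies above its tangent at `a`.
This is the only form in which the convexity assumption is used later. -/
theorem quadratic_lower_bound (hL : ContDiff ℝ 2 L) (hγ : ∀ q, γ ≤ iteratedDeriv 2 L q)
    (a q : ℝ) : L a + deriv L a * (q - a) + γ / 2 * (q - a) ^ 2 ≤ L q := by
  have hd : Differentiable ℝ L := hL.differentiable (by norm_num)
  have hd' : Differentiable ℝ (deriv L) := by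
    have : ContDiff ℝ 1 (deriv L) := ((contDiff_succ_iff_deriv (n := 1)).1 hL).2.2
    exact this.differentiable (by norm_num)
  have h1 : ∀ x, HasDerivAt (fun x => L x - γ / 2 * (x - a) ^ 2) (deriv L x - γ * (x - a)) x := by
    intro x
    have := (hd x).hasDerivAt.sub ((((hasDerivAt_id x).sub_const a).pow 2).const_mul (γ / 2))
    refine this.congr_deriv ?_
    simp
    ring
  have h2 : ∀ x, HasDerivAt (fun x => deriv L x - γ * (x - a)) (deriv (deriv L) x - γ) x := by
    intro x
    have := (hd' x).hasDerivAt.sub (((hasDerivAt_id x).sub_const a).const_mul γ)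
    exact this.congr_deriv (by simp)
  have e1 : deriv (fun x => L x - γ / 2 * (x - a) ^ 2) = fun x => deriv L x - γ * (x - a) :=
    funext fun x => (h1 x).deriv
  have hconv : ConvexOn ℝ univ (fun x => L x - γ / 2 * (x - a) ^ 2) := by
    refine convexOn_univ_of_deriv2_nonneg (fun x => (h1 x).differentiableAt) ?_ ?_
    · rw [e1]; exact fun x => (h2 x).differentiableAt
    · intro x
      have := hγ x
      rw [iteratedDeriv_eq_iterate] at this
      simp only [Function.iterate_succ, Function.iterate_zero, Function.comp_apply, id] at this ⊢
      rw [e1, (h2 x).deriv]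
      linarith
  have ha := h1 a
  simp only [sub_self, mul_zero, sub_zero] at ha
  rcases lt_trichotomy a q with h | h | h
  · have := hconv.le_slope_of_hasDerivAt (mem_univ a) (mem_univ q) h ha
    rw [slope_def_field, le_div_iff₀ (by linarith)] at this
    simp only [sub_self] at this
    linarith
  · subst h; simp
  · have := hconv.slope_le_of_hasDerivAt (mem_univ q) (mem_univ a) h ha
    rw [slope_def_field, div_le_iff₀ (by linarith)] at this
    simp only [sub_self] at this
    linarith

theorem exists_forall_mul_sub_le (hγ0 : 0 < γ)
    (hL : ∀ a q, L a + deriv L a * (q - a) + γ / 2 * (q - a) ^ 2 ≤ L q) (p : ℝ) :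
    ∃ B, ∀ q, p * q - L q ≤ B := by
  refine ⟨(p - deriv L 0) ^ 2 / (2 * γ) - L 0, fun q => ?_⟩
  have h := hL 0 q
  have : (p - deriv L 0) * q - γ / 2 * q ^ 2 ≤ (p - deriv L 0) ^ 2 / (2 * γ) := by
    rw [le_div_iff₀ (by positivity)]
    nlinarith [sq_nonneg (p - deriv L 0 - γ * q)]
  simp only [sub_zero] at h
  linarith

theorem mul_sub_le_hamiltonian (hb : ∀ p, ∃ B, ∀ q, p * q - L q ≤ B) (p q : ℝ) :
    p * q - L q ≤ hamiltonian L p := by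
  obtain ⟨B, hB⟩ := hb p
  exact le_ciSup (f := fun q => p * q - L q) ⟨B, by rintro _ ⟨q, rfl⟩; exact hB q⟩ q

theorem mul_sub_le_hamiltonianNeg (hb : ∀ p, ∃ B, ∀ q, p * q - L q ≤ B) (p : ℝ) {q : ℝ}
    (hq : q ≤ 0) : p * q - L q ≤ hamiltonianNeg L p := by
  obtain ⟨B, hB⟩ := hb p
  exact le_ciSup (f := fun q : Iic (0 : ℝ) => p * (q : ℝ) - L q)
    ⟨B, by rintro _ ⟨q, rfl⟩; exact hB q⟩ ⟨q, hq⟩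

theorem hamiltonian_le {p b : ℝ} (h : ∀ q, p * q - L q ≤ b) : hamiltonian L p ≤ b :=
  ciSup_le h

theorem hamiltonianNeg_le {p b : ℝ} (h : ∀ q ≤ 0, p * q - L q ≤ b) : hamiltonianNeg L p ≤ b :=
  haveI : Nonempty (Iic (0 : ℝ)) := ⟨⟨0, mem_Iic.2 le_rfl⟩⟩
  ciSup_le fun q => h q q.2

/-- Every level `b > -L 0` is the value of the conjugate of `L` at a slope whose optimal velocity
is negative. -/
theorem exists_neg_velocity (hγ0 : 0 < γ) (hLd : ContDiff ℝ 2 L)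
    (hL : ∀ a q, L a + deriv L a * (q - a) + γ / 2 * (q - a) ^ 2 ≤ L q) {b : ℝ}
    (hb : -L 0 < b) :
    ∃ q < 0, ∃ p, p * q - L q = b ∧ ∀ q', p * q' - L q' ≤ b := by
  -- `G q` is the value of the conjugate at the slope `deriv L q`, whose optimal velocity is `q`.
  -- Since `G 0 = -L 0`, the level `b` is found by the intermediate value theorem on the negative
  -- side.
  set G : ℝ → ℝ := fun q => deriv L q * q - L q with hG
  have hGc : Continuous G := by
    have h1 : Continuous (deriv L) := hLd.continuous_deriv (by norm_num)
    have h2 : Continuous L := hLd.continuous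
    fun_prop
  -- The quadratic bound based at `-M` and evaluated at `0` gives `G (-M) ≥ γ / 2 * M ^ 2 - L 0`,
  -- which exceeds `b` for this `M ≥ 1`.
  set M : ℝ := 2 * (b + L 0) / γ + 1 with hM
  have hbpos : 0 < b + L 0 := by linarith
  have hM1 : 1 ≤ M := by
    have : 0 ≤ 2 * (b + L 0) / γ := by positivity
    linarith
  have hGM : b ≤ G (-M) := by
    have h := hL (-M) 0
    have h3 : γ * M = 2 * (b + L 0) + γ := by rw [hM]; field_simp
    have h4 : γ * M ≤ γ * M * M := by nlinarith [mul_pos hγ0 (by linarith : 0 < M)]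
    simp only [hG]
    nlinarith
  have hG0 : G 0 < b := by simp only [hG]; linarith
  obtain ⟨q, hq, hqb⟩ := intermediate_value_Icc' (by linarith : -M ≤ 0) hGc.continuousOn
    ⟨hG0.le, hGM⟩
  have hq0 : q ≠ 0 := by rintro rfl; linarith
  refine ⟨q, lt_of_le_of_ne hq.2 hq0, deriv L q, hqb, fun q' => ?_⟩
  have h := hL q q'
  have : 0 ≤ γ / 2 * (q' - q) ^ 2 := by positivity
  simp only [hG] at hqb
  linarith

end Lagrangian

/-- Penalization: for a large penalty `k`, the points of a compact set where `f - k g ≥ m` lie in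
any open set that contains the points where `g = 0` and `f ≥ m`. -/
theorem eventually_forall_mem_of_penalized {X : Type*} [TopologicalSpace X] {K U : Set X}
    {f g : X → ℝ} {m : ℝ} (hK : IsCompact K) (hU : IsOpen U) (hf : UpperSemicontinuousOn f K)
    (hg : Continuous g) (hg0 : ∀ z, 0 ≤ g z) (h : ∀ z ∈ K, g z = 0 → m ≤ f z → z ∈ U) :
    ∀ᶠ k : ℕ in atTop, ∀ z ∈ K, m ≤ f z - k * g z → z ∈ U := by
  have key : ∀ᶠ k : ℕ in atTop, ∀ z ∈ K \ U, f z - k * g z < m := by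
    -- The claim passes to subsets and finite unions, so it is enough to prove it near each point of
    -- `K \ U`. There one good `k` is spread to a neighbourhood by upper semicontinuity, and to all
    -- larger `k` by `g ≥ 0`.
    refine (hK.diff hU).induction_on (p := fun S => ∀ᶠ k : ℕ in atTop, ∀ z ∈ S, f z - k * g z < m)
      (by simp) (fun s t hst ht => ht.mono fun k hk z hz => hk z (hst hz)) ?_ ?_
    · intro s t hs ht
      filter_upwards [hs, ht] with k h1 h2 z hz
      exact hz.elim (h1 z) (h2 z)
    · rintro x ⟨hxK, hxU⟩
      obtain ⟨k, hk⟩ : ∃ k : ℕ, f x - k * g x < m := by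
        rcases (hg0 x).eq_or_lt with h0 | h0
        · refine ⟨0, ?_⟩
          by_contra! hc
          exact hxU (h x hxK h0.symm (by simpa using hc))
        · obtain ⟨k, hk⟩ := exists_nat_gt ((f x - m) / g x)
          exact ⟨k, by rw [div_lt_iff₀ h0] at hk; linarith⟩
      have hus : UpperSemicontinuousOn (fun z => f z + -(k * g z)) K :=
        hf.add (Continuous.continuousOn (by fun_prop)).upperSemicontinuousOn
      have := hus x hxK m (by linarith)
      refine ⟨{z | f z + -(k * g z) < m}, nhdsWithin_mono x sdiff_subset this, ?_⟩
      filter_upwards [eventually_ge_atTop k] with k' hk' z hz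
      have : (k : ℝ) * g z ≤ k' * g z := by
        gcongr
        exact hg0 z
      have hz' : f z + -(k * g z) < m := hz
      linarith
  filter_upwards [key] with k hk z hz hm
  by_contra hc
  exact absurd (hk z ⟨hz, hc⟩) (by linarith)

end HJJunction

namespace HJJunction

open Set Filter Topology

/-! ### Geometry of the junction, and test functions glued from branch coordinates. -/

section Geometry

variable {N : ℕ} {e : Fin N → Plane}

theorem norm_smul_branch (he : ∀ i, ‖e i‖ = 1) (i : Fin N) {r : ℝ} (hr : 0 ≤ r) :
    ‖r • e i‖ = r := by
  rw [norm_smul, he, mul_one, Real.norm_of_nonneg hr]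

theorem smul_mem_junction (i : Fin N) {r : ℝ} (hr : 0 ≤ r) : r • e i ∈ junction e :=
  mem_iUnion.2 ⟨i, r, hr, rfl⟩

theorem exists_of_mem_junction {x : Plane} (hx : x ∈ junction e) :
    ∃ i, ∃ r : ℝ, 0 ≤ r ∧ x = r • e i := by
  obtain ⟨i, r, hr, rfl⟩ := mem_iUnion.1 hx
  exact ⟨i, r, hr, rfl⟩

theorem eq_of_smul_eq_smul (he : ∀ i, ‖e i‖ = 1) (hinj : Function.Injective e) {i j : Fin N}
    {r s : ℝ} (hr : 0 < r) (hs : 0 ≤ s) (h : r • e i = s • e j) : i = j := by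
  have hrs : r = s := by
    rw [← norm_smul_branch he i hr.le, h, norm_smul_branch he j hs]
  subst hrs
  exact hinj (smul_right_injective Plane hr.ne' h)

theorem isClosed_branch (he : ∀ i, ‖e i‖ = 1) (i : Fin N) : IsClosed (branch e i) := by
  have : Isometry (fun r : ℝ => r • e i) := by
    refine Isometry.of_dist_eq fun r s => ?_
    rw [dist_eq_norm, ← sub_smul, norm_smul, he, mul_one, Real.dist_eq, Real.norm_eq_abs]
  exact this.isClosedEmbedding.isClosedMap _ isClosed_Ici

/-- Near an interior point of a branch, the junction coincides with this branch. -/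
theorem eventually_mem_branch (he : ∀ i, ‖e i‖ = 1) (hinj : Function.Injective e) (i : Fin N)
    {r : ℝ} (hr : 0 < r) : ∀ᶠ x in 𝓝 (r • e i), x ∈ junction e → x ∈ branch e i := by
  have hcl : IsClosed (⋃ j ∈ {j : Fin N | j ≠ i}, branch e j) :=
    (Set.toFinite _).isClosed_biUnion fun j _ => isClosed_branch he j
  have hnot : r • e i ∉ ⋃ j ∈ {j : Fin N | j ≠ i}, branch e j := by
    simp only [mem_iUnion, not_exists]
    rintro j hj ⟨s, hs, h⟩
    exact hj (eq_of_smul_eq_smul he hinj hr hs h.symm).symm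
  filter_upwards [hcl.isOpen_compl.mem_nhds hnot] with x hx hxJ
  obtain ⟨j, hj⟩ := mem_iUnion.1 hxJ
  by_contra hc
  refine hx (mem_biUnion (x := j) ?_ hj)
  rintro rfl
  exact hc hj

open Classical in
/-- The function on `ℝ × J` given by `f i` in the coordinates of the branch `J_i`. -/
noncomputable def glue (e : Fin N → Plane) (f : Fin N → ℝ × ℝ → ℝ) (z : ℝ × Plane) : ℝ :=
  if h : z.2 ∈ junction e then f (mem_iUnion.1 h).choose (z.1, ‖z.2‖) else 0

theorem glue_apply (he : ∀ i, ‖e i‖ = 1) (hinj : Function.Injective e)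
    {f : Fin N → ℝ × ℝ → ℝ} (hf0 : ∀ i j t, f i (t, 0) = f j (t, 0)) (i : Fin N) (t : ℝ) {r : ℝ}
    (hr : 0 ≤ r) : glue e f (t, r • e i) = f i (t, r) := by
  have h : r • e i ∈ junction e := smul_mem_junction i hr
  simp only [glue, h, dif_pos, norm_smul_branch he i hr]
  rcases hr.eq_or_lt with rfl | hr'
  · exact hf0 _ _ _
  · obtain ⟨s, hs, hse⟩ := (mem_iUnion.1 h).choose_spec
    rw [← eq_of_smul_eq_smul he hinj hr' hs hse.symm]

/-- The branches are closed and finitely many, so continuity may be checked on each one, where the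
norm is the radial coordinate. -/
theorem isTestFunction_glue (he : ∀ i, ‖e i‖ = 1) (hinj : Function.Injective e) (T : ℝ)
    {f : Fin N → ℝ × ℝ → ℝ} (hf : ∀ i, ContDiff ℝ 1 (f i))
    (hf0 : ∀ i j t, f i (t, 0) = f j (t, 0)) : IsTestFunction e T (glue e f) := by
  constructor
  · have hU : domainT e T ⊆ ⋃ i, (univ : Set ℝ) ×ˢ branch e i := by
      rintro ⟨t, x⟩ ⟨-, hx⟩
      obtain ⟨i, hi⟩ := mem_iUnion.1 hx
      exact mem_iUnion.2 ⟨i, mem_univ _, hi⟩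
    refine ContinuousOn.mono ?_ hU
    refine (locallyFinite_of_finite _).continuousOn_iUnion
      (fun i => isClosed_univ.prod (isClosed_branch he i)) fun i => ?_
    have hc : Continuous fun z : ℝ × Plane => f i (z.1, ‖z.2‖) := by
      have := (hf i).continuous
      fun_prop
    refine hc.continuousOn.congr ?_
    rintro ⟨t, x⟩ ⟨-, r, hr, rfl⟩
    simp only [glue_apply he hinj hf0 i t hr, norm_smul_branch he i hr]
  · intro i
    refine (hf i).contDiffOn.congr ?_
    rintro ⟨t, r⟩ ⟨-, hr⟩
    exact glue_apply he hinj hf0 i t hr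

theorem timeDeriv_glue (he : ∀ i, ‖e i‖ = 1) (hinj : Function.Injective e)
    {f : Fin N → ℝ × ℝ → ℝ} (hf0 : ∀ i j t, f i (t, 0) = f j (t, 0)) {i : Fin N} {t r a : ℝ}
    (hr : 0 ≤ r) (ha : HasDerivAt (fun s => f i (s, r)) a t) :
    timeDeriv (glue e f) t (r • e i) = a := by
  unfold timeDeriv
  simp only [glue_apply he hinj hf0 i _ hr]
  exact ha.deriv

theorem branchDeriv_glue (he : ∀ i, ‖e i‖ = 1) (hinj : Function.Injective e)
    {f : Fin N → ℝ × ℝ → ℝ} (hf0 : ∀ i j t, f i (t, 0) = f j (t, 0)) {i : Fin N} {t r p : ℝ}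
    (hr : 0 ≤ r) (hp : HasDerivAt (fun ρ => f i (t, ρ)) p r) :
    branchDeriv e (glue e f) i t r = p := by
  unfold branchDeriv
  refine HasDerivWithinAt.derivWithin ?_ (uniqueDiffOn_Ici 0 r hr)
  exact hp.hasDerivWithinAt.congr (fun ρ hρ => glue_apply he hinj hf0 i t hρ)
    (glue_apply he hinj hf0 i t hr)

/-- A property that holds near an interior point in the coordinates of a branch holds near this
point on the junction. -/
theorem eventually_nhdsWithin_of_branch (he : ∀ i, ‖e i‖ = 1) (hinj : Function.Injective e)
    (T : ℝ) {P : ℝ × Plane → Prop} {i : Fin N} {t r : ℝ} (hr : 0 < r)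
    (h : ∀ᶠ z : ℝ × ℝ in 𝓝 (t, r), P (z.1, z.2 • e i)) :
    ∀ᶠ Q in 𝓝[domainT e T] (t, r • e i), P Q := by
  have hc : Tendsto (fun Q : ℝ × Plane => (Q.1, ‖Q.2‖)) (𝓝 (t, r • e i)) (𝓝 (t, r)) := by
    have : Continuous fun Q : ℝ × Plane => (Q.1, ‖Q.2‖) := by fun_prop
    simpa [norm_smul_branch he i hr.le] using this.tendsto (t, r • e i)
  have hb := (continuous_snd.tendsto (t, r • e i)).eventually (eventually_mem_branch he hinj i hr)
  rw [eventually_nhdsWithin_iff]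
  filter_upwards [hc.eventually h, hb] with Q h1 h2 hQ
  obtain ⟨s, hs, hse⟩ := h2 hQ.2
  have hs' : s • e i = Q.2 := hse
  have hn : ‖Q.2‖ = s := by rw [← hs', norm_smul_branch he i hs]
  simpa only [hn, hs'] using h1

theorem eventually_nhdsWithin_of_junction (he : ∀ i, ‖e i‖ = 1)
    (T : ℝ) {P : ℝ × Plane → Prop} {t : ℝ}
    (h : ∀ i, ∀ᶠ z : ℝ × ℝ in 𝓝 (t, 0), 0 ≤ z.2 → P (z.1, z.2 • e i)) :
    ∀ᶠ Q in 𝓝[domainT e T] (t, 0), P Q := by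
  have hc : Tendsto (fun Q : ℝ × Plane => (Q.1, ‖Q.2‖)) (𝓝 (t, 0)) (𝓝 (t, 0)) := by
    have : Continuous fun Q : ℝ × Plane => (Q.1, ‖Q.2‖) := by fun_prop
    simpa using this.tendsto (t, 0)
  rw [eventually_nhdsWithin_iff]
  filter_upwards [hc.eventually (eventually_all.2 h)] with Q h1 hQ
  obtain ⟨i, s, hs, hse⟩ := exists_of_mem_junction hQ.2
  have hn : ‖Q.2‖ = s := by rw [hse, norm_smul_branch he i hs]
  have := h1 i (norm_nonneg _)
  simpa only [hn, ← hse] using this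

end Geometry

/-! ### The viscosity inequalities in branch coordinates. -/

section Coordinates

variable {N : ℕ} {e : Fin N → Plane} {L : Fin N → ℝ → ℝ} {T : ℝ} {u v : ℝ × Plane → ℝ}

theorem IsSubsolution.le_of_branch (hu : IsSubsolution e L T u) (he : ∀ i, ‖e i‖ = 1)
    (hinj : Function.Injective e) {i : Fin N} {t r a p : ℝ} (ht : t ∈ Ioo 0 T) (hr : 0 < r)
    {f : ℝ × ℝ → ℝ} (hf : ContDiff ℝ 1 f) (ha : HasDerivAt (fun s => f (s, r)) a t)
    (hp : HasDerivAt (fun ρ => f (t, ρ)) p r)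
    (hle : ∀ᶠ z : ℝ × ℝ in 𝓝 (t, r), u (z.1, z.2 • e i) ≤ f z) (heq : u (t, r • e i) = f (t, r)) :
    a + hamiltonian (L i) p ≤ 0 := by
  classical
  -- On the other branches `f` is extended by its value at `r = 0`, which makes the pieces match at
  -- the junction point; the touching condition near an interior point of branch `i` does not see
  -- them.
  set F : Fin N → ℝ × ℝ → ℝ := fun j z => f (z.1, if j = i then z.2 else 0) with hF
  have hFi : F i = f := by simp [hF]
  have hFd : ∀ j, ContDiff ℝ 1 (F j) := by
    intro j
    by_cases hj : j = i
    · rw [hj, hFi]; exact hf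
    · simp only [hF, hj, if_false]
      exact hf.comp (contDiff_fst.prodMk contDiff_const)
  have hF0 : ∀ j k t, F j (t, 0) = F k (t, 0) := by intro j k t; simp [hF]
  have hg : ∀ (t : ℝ) {r : ℝ}, 0 ≤ r → glue e F (t, r • e i) = f (t, r) := fun t r hr => by
    rw [glue_apply he hinj hF0 i t hr, hFi]
  have := hu.branch_le (glue e F) (isTestFunction_glue he hinj T hFd hF0) t ht i r hr ⟨?_, ?_⟩
  · rwa [branchOperator, timeDeriv_glue he hinj hF0 hr.le (by rw [hFi]; exact ha),
      branchDeriv_glue he hinj hF0 hr.le (by rw [hFi]; exact hp)] at this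
  · refine eventually_nhdsWithin_of_branch he hinj T hr ?_
    have h0 : ∀ᶠ z : ℝ × ℝ in 𝓝 (t, r), 0 < z.2 :=
      (continuous_snd.tendsto (t, r)).eventually (lt_mem_nhds hr)
    filter_upwards [hle, h0] with z h1 h2
    rwa [hg z.1 h2.le]
  · rw [hg t hr.le, heq]

theorem IsSupersolution.ge_of_branch (hv : IsSupersolution e L T v) (he : ∀ i, ‖e i‖ = 1)
    (hinj : Function.Injective e) {i : Fin N} {t r a p : ℝ} (ht : t ∈ Ioo 0 T) (hr : 0 < r)
    {f : ℝ × ℝ → ℝ} (hf : ContDiff ℝ 1 f) (ha : HasDerivAt (fun s => f (s, r)) a t)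
    (hp : HasDerivAt (fun ρ => f (t, ρ)) p r)
    (hle : ∀ᶠ z : ℝ × ℝ in 𝓝 (t, r), f z ≤ v (z.1, z.2 • e i)) (heq : v (t, r • e i) = f (t, r)) :
    0 ≤ a + hamiltonian (L i) p := by
  classical
  set F : Fin N → ℝ × ℝ → ℝ := fun j z => f (z.1, if j = i then z.2 else 0) with hF
  have hFi : F i = f := by simp [hF]
  have hFd : ∀ j, ContDiff ℝ 1 (F j) := by
    intro j
    by_cases hj : j = i
    · rw [hj, hFi]; exact hf
    · simp only [hF, hj, if_false]
      exact hf.comp (contDiff_fst.prodMk contDiff_const)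
  have hF0 : ∀ j k t, F j (t, 0) = F k (t, 0) := by intro j k t; simp [hF]
  have hg : ∀ (t : ℝ) {r : ℝ}, 0 ≤ r → glue e F (t, r • e i) = f (t, r) := fun t r hr => by
    rw [glue_apply he hinj hF0 i t hr, hFi]
  have := hv.branch_ge (glue e F) (isTestFunction_glue he hinj T hFd hF0) t ht i r hr ⟨?_, ?_⟩
  · rwa [branchOperator, timeDeriv_glue he hinj hF0 hr.le (by rw [hFi]; exact ha),
      branchDeriv_glue he hinj hF0 hr.le (by rw [hFi]; exact hp)] at this
  · refine eventually_nhdsWithin_of_branch he hinj T hr ?_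
    have h0 : ∀ᶠ z : ℝ × ℝ in 𝓝 (t, r), 0 < z.2 :=
      (continuous_snd.tendsto (t, r)).eventually (lt_mem_nhds hr)
    filter_upwards [hle, h0] with z h1 h2
    rwa [hg z.1 h2.le]
  · rw [hg t hr.le, heq]

theorem junctionOperator_glue (he : ∀ i, ‖e i‖ = 1) (hinj : Function.Injective e)
    {f : Fin N → ℝ × ℝ → ℝ} (hf0 : ∀ i j t, f i (t, 0) = f j (t, 0)) {t a : ℝ} {p : Fin N → ℝ}
    (i : Fin N) (ha : HasDerivAt (fun s => f i (s, 0)) a t)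
    (hp : ∀ j, HasDerivAt (fun ρ => f j (t, ρ)) (p j) 0) :
    junctionOperator e L (glue e f) t = a + ⨆ j, hamiltonianNeg (L j) (p j) := by
  have h1 := timeDeriv_glue he hinj hf0 le_rfl ha
  rw [zero_smul] at h1
  rw [junctionOperator, h1]
  congr 2
  ext j
  rw [branchDeriv_glue he hinj hf0 le_rfl (hp j)]

theorem IsSubsolution.le_of_junction (hu : IsSubsolution e L T u) (he : ∀ i, ‖e i‖ = 1)
    (hinj : Function.Injective e) {t a : ℝ} {p : Fin N → ℝ} (ht : t ∈ Ioo 0 T)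
    {f : Fin N → ℝ × ℝ → ℝ} (hf : ∀ i, ContDiff ℝ 1 (f i))
    (hf0 : ∀ i j t, f i (t, 0) = f j (t, 0)) (i : Fin N)
    (ha : HasDerivAt (fun s => f i (s, 0)) a t)
    (hp : ∀ j, HasDerivAt (fun ρ => f j (t, ρ)) (p j) 0)
    (hle : ∀ j, ∀ᶠ z : ℝ × ℝ in 𝓝 (t, 0), 0 ≤ z.2 → u (z.1, z.2 • e j) ≤ f j z)
    (heq : u (t, 0) = f i (t, 0)) (j : Fin N) :
    a + hamiltonianNeg (L j) (p j) ≤ 0 := by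
  have hg := fun i t {r : ℝ} (hr : 0 ≤ r) => glue_apply he hinj hf0 i t hr
  have := hu.junction_le (glue e f) (isTestFunction_glue he hinj T hf hf0) t ht ⟨?_, ?_⟩
  · rw [junctionOperator_glue he hinj hf0 i ha hp] at this
    have h2 := le_ciSup (Set.finite_range fun j => hamiltonianNeg (L j) (p j)).bddAbove j
    linarith
  · refine eventually_nhdsWithin_of_junction he T fun j => ?_
    filter_upwards [hle j] with z hz h0
    rw [hg j z.1 h0]
    exact hz h0
  · have := hg i t le_rfl
    rw [zero_smul] at this
    rw [this, heq]

theorem IsSupersolution.ge_of_junction (hv : IsSupersolution e L T v) (he : ∀ i, ‖e i‖ = 1)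
    (hinj : Function.Injective e) {t a : ℝ} {p : Fin N → ℝ} (ht : t ∈ Ioo 0 T)
    {f : Fin N → ℝ × ℝ → ℝ} (hf : ∀ i, ContDiff ℝ 1 (f i))
    (hf0 : ∀ i j t, f i (t, 0) = f j (t, 0)) (i : Fin N)
    (ha : HasDerivAt (fun s => f i (s, 0)) a t)
    (hp : ∀ j, HasDerivAt (fun ρ => f j (t, ρ)) (p j) 0)
    (hle : ∀ j, ∀ᶠ z : ℝ × ℝ in 𝓝 (t, 0), 0 ≤ z.2 → f j z ≤ v (z.1, z.2 • e j))
    (heq : v (t, 0) = f i (t, 0)) :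
    0 ≤ a + ⨆ j, hamiltonianNeg (L j) (p j) := by
  have hg := fun i t {r : ℝ} (hr : 0 ≤ r) => glue_apply he hinj hf0 i t hr
  have := hv.junction_ge (glue e f) (isTestFunction_glue he hinj T hf hf0) t ht ⟨?_, ?_⟩
  · rwa [junctionOperator_glue he hinj hf0 i ha hp] at this
  · refine eventually_nhdsWithin_of_junction he T fun j => ?_
    filter_upwards [hle j] with z hz h0
    rw [hg j z.1 h0]
    exact hz h0
  · have := hg i t le_rfl
    rw [zero_smul] at this
    rw [this, heq]

end Coordinates

end HJJunction

namespace HJJunction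

open Set Filter Topology

/-! ### Suboptimality of sub-solutions along trajectories. -/

section Suboptimality

variable {N : ℕ} {e : Fin N → Plane} {L : Fin N → ℝ → ℝ} {T : ℝ} {u v : ℝ × Plane → ℝ}

theorem continuous_coordinates (e : Fin N → Plane) :
    Continuous fun z : Fin N × ℝ × ℝ => (z.2.1, z.2.2 • e z.1) := by
  have : Continuous e := continuous_of_discreteTopology
  fun_prop

theorem upperSemicontinuousOn_coordinates (hu : UpperSemicontinuousOn u (domainT0 e T)) :
    UpperSemicontinuousOn (fun z : Fin N × ℝ × ℝ => u (z.2.1, z.2.2 • e z.1))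
      (univ ×ˢ Ico 0 T ×ˢ Ici 0) :=
  hu.comp (continuous_coordinates e).continuousOn fun _ hz => ⟨hz.2.1, smul_mem_junction _ hz.2.2⟩

theorem upperSemicontinuousOn_branch (hu : UpperSemicontinuousOn u (domainT0 e T)) {s : ℝ}
    (hs : s ∈ Ico 0 T) (i : Fin N) :
    UpperSemicontinuousOn (fun r : ℝ => u (s, r • e i)) (Ici 0) :=
  hu.comp (g := fun r : ℝ => (s, r • e i)) (Continuous.continuousOn (by fun_prop))
    fun _ hr => ⟨hs, smul_mem_junction _ hr⟩

/-- The barrier along the trajectory `τ ↦ y + q (τ - s)`. -/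
noncomputable def barrier (s y q A c n t k α β : ℝ) (z : ℝ × ℝ) : ℝ :=
  A * (z.1 - s) + c * Real.exp (n * (z.1 - t)) + k * (α * z.2 - (y + q * (z.1 - s))) ^ 2 + β * z.2

theorem contDiff_barrier (s y q A c n t k α β : ℝ) :
    ContDiff ℝ 1 (barrier s y q A c n t k α β) := by
  unfold barrier
  fun_prop

theorem hasDerivAt_barrier_fst (s y q A c n t k α β τ z : ℝ) :
    HasDerivAt (fun τ => barrier s y q A c n t k α β (τ, z))
      (A + c * n * Real.exp (n * (τ - t)) - 2 * k * (α * z - (y + q * (τ - s))) * q) τ := by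
  unfold barrier
  have h1 := ((hasDerivAt_id τ).sub_const s).const_mul A
  have h2 := ((((hasDerivAt_id τ).sub_const t).const_mul n).exp).const_mul c
  have h3 := (((((((hasDerivAt_id τ).sub_const s).const_mul q).const_add y).const_sub
    (α * z))).pow 2).const_mul k
  refine (((h1.add h2).add h3).add_const (β * z)).congr_deriv ?_
  simp
  ring

theorem hasDerivAt_barrier_snd (s y q A c n t k α β τ z : ℝ) :
    HasDerivAt (fun z => barrier s y q A c n t k α β (τ, z))
      (2 * k * α * (α * z - (y + q * (τ - s))) + β) z := by
  unfold barrier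
  have h3 := ((((hasDerivAt_id z).const_mul α).sub_const (y + q * (τ - s))).pow 2).const_mul k
  have h4 := (hasDerivAt_id z).const_mul β
  refine (((h3.const_add (A * (τ - s) + c * Real.exp (n * (τ - t))))).add h4).congr_deriv ?_
  simp
  ring

-- Maximize `u - F`, where `F` is the barrier on branch `i` and has the large slope `K` on the other
-- branches. The penalty around the trajectory, the exponential in time and the slope `K` exclude
-- the boundary of the compact window. At any remaining point, `F` is a strict super-solution
-- because velocity `q` is admissible in the Hamiltonian, and the growing exponential supplies the
-- strictness. The error `2 * c` is removed afterwards.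
set_option maxHeartbeats 1000000 in
theorem IsSubsolution.le_add_of_pos (hu : IsSubsolution e L T u) (he : ∀ i, ‖e i‖ = 1)
    (hinj : Function.Injective e) (hL : ∀ i p, ∃ B, ∀ q, p * q - L i q ≤ B)
    {i : Fin N} {s h y q c : ℝ} (hs : 0 ≤ s) (hh : 0 < h) (hsh : s + h < T) (hy : 0 < y)
    (hx : 0 ≤ y + h * q) (hc : 0 < c) :
    u (s + h, (y + h * q) • e i) ≤ u (s, y • e i) + h * L i q + 2 * c := by
  -- The window extends beyond `s + h`, leaving room for the exponential to grow from `c` at time `s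
  -- + h` to more than `D` at time `t'`.
  set t' : ℝ := (s + h + T) / 2 with ht'
  have ht1 : s + h < t' := by linarith
  have ht2 : t' < T := by linarith
  have hd : 0 < t' - s := by linarith
  set R : ℝ := y + |q| * (t' - s) + 1 with hR
  have hqd : 0 ≤ |q| * (t' - s) := by positivity
  have hR1 : 1 ≤ R := by linarith
  set Kc : Set (Fin N × ℝ × ℝ) := univ ×ˢ Icc s t' ×ˢ Icc 0 R with hKc
  have hKcomp : IsCompact Kc := isCompact_univ.prod (isCompact_Icc.prod isCompact_Icc)
  have hKsub : Kc ⊆ univ ×ˢ Ico 0 T ×ˢ Ici 0 := by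
    rintro ⟨j, τ, z⟩ ⟨-, hτ, hz⟩
    exact ⟨mem_univ _, ⟨hs.trans hτ.1, lt_of_le_of_lt hτ.2 ht2⟩, hz.1⟩
  have husc := (upperSemicontinuousOn_coordinates hu.upperSemicontinuousOn).mono hKsub
  obtain ⟨B, hB⟩ := husc.bddAbove_of_isCompact hKcomp
  set u0 : ℝ := u (s, y • e i) with hu0
  set A : ℝ := L i q with hA
  set D : ℝ := |B - u0| + |A| * (t' - s) with hD
  have hD0 : 0 ≤ D := by positivity
  have hDb : ∀ j τ z, (j, τ, z) ∈ Kc → u (τ, z • e j) - u0 - A * (τ - s) ≤ D := by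
    intro j τ z hz
    have h1 : u (τ, z • e j) ≤ B := hB ⟨_, hz, rfl⟩
    have h2 := le_abs_self (B - u0)
    have hτ := hz.2.1
    have h3 : -(A * (τ - s)) ≤ |A| * (t' - s) := by
      calc -(A * (τ - s)) ≤ |A| * (τ - s) := by
            have := neg_abs_le A
            nlinarith [hτ.1]
        _ ≤ _ := by gcongr; exact hτ.2
    linarith
  -- The radius comes from upper semicontinuity at the starting point. The bound `ρ ≤ y` makes the
  -- junction point count as far from `y`, and `ρ ≤ 1` makes `z = R` count as far from the
  -- trajectory.
  obtain ⟨ρ, hρ0, hρ1, hρy, hρ⟩ : ∃ ρ, 0 < ρ ∧ ρ ≤ 1 ∧ ρ ≤ y ∧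
      ∀ z, 0 ≤ z → |z - y| < ρ → u (s, z • e i) < u0 + c := by
    have h1 := upperSemicontinuousOn_branch hu.upperSemicontinuousOn
      (⟨hs, by linarith⟩ : s ∈ Ico 0 T) i y hy.le (u0 + c) (by simp only [hu0]; linarith)
    rw [eventually_nhdsWithin_iff, Metric.eventually_nhds_iff] at h1
    obtain ⟨ε, hε, h1⟩ := h1
    refine ⟨min ε (min 1 y), by positivity, (min_le_right _ _).trans (min_le_left _ _),
      (min_le_right _ _).trans (min_le_right _ _), fun z hz hzy => ?_⟩
    exact h1 (by rw [Real.dist_eq]; exact hzy.trans_le (min_le_left _ _)) hz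
  set k : ℝ := D / ρ ^ 2 with hk
  have hk0 : 0 ≤ k := by positivity
  have hkD : ∀ x, ρ ≤ |x| → D ≤ k * x ^ 2 := by
    intro x hx
    have : ρ ^ 2 ≤ x ^ 2 := by rw [← sq_abs x]; gcongr
    calc D = k * ρ ^ 2 := by rw [hk]; field_simp
      _ ≤ _ := by gcongr
  set n : ℝ := (D + 1) / (c * (t' - (s + h))) with hn
  have hth : 0 < t' - (s + h) := by linarith
  have hn0 : 0 < n := by positivity
  have hnD : D < c * Real.exp (n * (t' - (s + h))) := by
    have h1 := Real.add_one_le_exp (n * (t' - (s + h)))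
    have h2 : c * (n * (t' - (s + h))) = D + 1 := by rw [hn]; field_simp
    nlinarith
  set S : ℝ := ∑ j, |L j 1| with hS
  have hSj : ∀ j, |L j 1| ≤ S := fun j =>
    Finset.single_le_sum (f := fun j => |L j 1|) (fun _ _ => abs_nonneg _) (Finset.mem_univ j)
  have hS0 : 0 ≤ S := (abs_nonneg _).trans (hSj i)
  -- On a branch `j ≠ i`, velocity `1` gives `H_j(K) ≥ K - L_j(1)`, which must dominate every other
  -- term of the equation; `K ≥ D` also excludes `z = R` there.
  set K : ℝ := D + |A| + 2 * k * (R * |q|) + S + 1 with hK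
  have hKD : D ≤ K := by
    have : 0 ≤ 2 * k * (R * |q|) := by positivity
    have := abs_nonneg A
    linarith
  set X : ℝ → ℝ := fun τ => y + q * (τ - s) with hX
  have hXR : ∀ τ ∈ Icc s t', |X τ| ≤ R - 1 := by
    intro τ hτ
    have h1 : |q * (τ - s)| ≤ |q| * (t' - s) := by
      rw [abs_mul, abs_of_nonneg (sub_nonneg.2 hτ.1)]
      gcongr
      exact hτ.2
    have := abs_add_le y (q * (τ - s))
    rw [abs_of_pos hy] at this
    simp only [hX]
    linarith
  set α : Fin N → ℝ := fun j => if j = i then 1 else 0 with hα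
  set β : Fin N → ℝ := fun j => if j = i then 0 else K with hβ
  have hαi : α i = 1 := if_pos rfl
  have hβi : β i = 0 := if_pos rfl
  have hαj : ∀ j ≠ i, α j = 0 := fun j hj => if_neg hj
  have hβj : ∀ j ≠ i, β j = K := fun j hj => if_neg hj
  have hβ0 : ∀ j, 0 ≤ β j := by
    intro j
    by_cases hj : j = i
    · rw [hj, hβi]
    · rw [hβj j hj]; linarith
  set F : Fin N → ℝ × ℝ → ℝ :=
    fun j => barrier s y q A c n (s + h) k (α j) (β j) with hF
  have hFv : ∀ j τ z, F j (τ, z) = A * (τ - s) + c * Real.exp (n * (τ - (s + h)))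
      + k * (α j * z - X τ) ^ 2 + β j * z := fun j τ z => rfl
  have hFusc : UpperSemicontinuousOn (fun z : Fin N × ℝ × ℝ =>
      u (z.2.1, z.2.2 • e z.1) + -(F z.1 z.2)) Kc := by
    refine husc.add (Continuous.continuousOn ?_).upperSemicontinuousOn
    have h1 : Continuous α := continuous_of_discreteTopology
    have h2 : Continuous β := continuous_of_discreteTopology
    simp only [hF, barrier]
    fun_prop
  have hPK : (i, s + h, y + h * q) ∈ Kc := by
    refine ⟨mem_univ _, ⟨by linarith, ht1.le⟩, hx, ?_⟩
    have : h * q ≤ |q| * (t' - s) := by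
      calc h * q ≤ h * |q| := by gcongr; exact le_abs_self q
        _ ≤ (t' - s) * |q| := by gcongr; linarith
        _ = _ := mul_comm _ _
    change y + h * q ≤ R
    linarith
  have hFd : ∀ M j, ContDiff ℝ 1 fun x => F j x + M := fun M j =>
    (contDiff_barrier s y q A c n (s + h) k (α j) (β j)).add contDiff_const
  have hF1 : ∀ M τ j z, HasDerivAt (fun τ => F j (τ, z) + M)
      (A + c * n * Real.exp (n * (τ - (s + h))) - 2 * k * (α j * z - X τ) * q) τ := fun M τ j z =>
    (hasDerivAt_barrier_fst s y q A c n (s + h) k (α j) (β j) τ z).add_const M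
  have hF2 : ∀ M τ j z, HasDerivAt (fun z => F j (τ, z) + M)
      (2 * k * α j * (α j * z - X τ) + β j) z := fun M τ j z =>
    (hasDerivAt_barrier_snd s y q A c n (s + h) k (α j) (β j) τ z).add_const M
  clear_value F α β
  obtain ⟨⟨j, τ, z⟩, hzK, hmax⟩ := hFusc.exists_isMaxOn ⟨_, hPK⟩ hKcomp
  have hmax' : ∀ j' τ' z', (j', τ', z') ∈ Kc →
      u (τ', z' • e j') - F j' (τ', z') ≤ u (τ, z • e j) - F j (τ, z) := by
    intro j' τ' z' h'
    have : u (τ', z' • e j') + -F j' (τ', z') ≤ u (τ, z • e j) + -F j (τ, z) := hmax h'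
    linarith
  -- At the target point the quadratic penalty vanishes and the exponential term equals `c`, so `F =
  -- h * A + c`.
  suffices hG : u (τ, z • e j) - F j (τ, z) ≤ u0 + c by
    have h1 := hmax' _ _ _ hPK
    rw [hFv, hαi, hβi] at h1
    have h2 : X (s + h) = y + h * q := by simp only [hX]; ring
    rw [h2] at h1
    simp only [add_sub_cancel_left, sub_self, mul_zero, Real.exp_zero, one_mul, zero_mul] at h1
    linarith
  by_contra! hG
  have hτ : τ ∈ Icc s t' := hzK.2.1
  have hz : z ∈ Icc 0 R := hzK.2.2
  have hE := hDb j τ z hzK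
  have hv := hFv j τ z
  have hexp : 0 < c * Real.exp (n * (τ - (s + h))) := by positivity
  have hsq : 0 ≤ k * (α j * z - X τ) ^ 2 := by positivity
  have hβz : 0 ≤ β j * z := mul_nonneg (hβ0 j) hz.1
  have hτt : τ < t' := by
    refine lt_of_le_of_ne hτ.2 ?_
    rintro rfl
    linarith
  have hzR : z < R := by
    refine lt_of_le_of_ne hz.2 ?_
    intro hzR
    by_cases hj : j = i
    · have h1 := hXR τ hτ
      have h2 := le_abs_self (X τ)
      have := hkD (α j * z - X τ) (by
        rw [hj, hαi, one_mul]
        exact hρ1.trans (le_trans (by linarith) (le_abs_self _)))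
      linarith
    · have : K * 1 ≤ K * z := by gcongr; linarith
      rw [hβj j hj] at hv hβz
      linarith
  have hτs : s < τ := by
    refine lt_of_le_of_ne hτ.1 ?_
    intro hτs
    have hXs : X τ = y := by rw [← hτs]; simp [hX]
    by_cases hj : j = i
    · by_cases hzy : |z - y| < ρ
      · have := hρ z hz.1 hzy
        rw [hj, ← hτs] at hG
        rw [hj, ← hτs] at hv
        have : A * (s - s) = 0 := by ring
        rw [hj] at hsq hβz
        rw [← hτs] at hexp hsq
        linarith
      · have := hkD (α j * z - X τ) (by rw [hj, hαi, one_mul, hXs]; exact not_lt.1 hzy)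
        linarith
    · have := hkD (α j * z - X τ) (by
        rw [hαj j hj, hXs, zero_mul, zero_sub, abs_neg, abs_of_pos hy]; exact hρy)
      linarith
  have hτT : τ ∈ Ioo 0 T := ⟨by linarith, by linarith⟩
  have hnexp : 0 < c * n * Real.exp (n * (τ - (s + h))) := by positivity
  set M : ℝ := u (τ, z • e j) - F j (τ, z) with hM
  have hτev : ∀ᶠ x : ℝ × ℝ in 𝓝 (τ, z), x.1 ∈ Icc s t' :=
    (continuous_fst.tendsto (τ, z)).eventually (Icc_mem_nhds hτs hτt)
  have hzev : ∀ᶠ x : ℝ × ℝ in 𝓝 (τ, z), x.2 < R :=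
    (continuous_snd.tendsto (τ, z)).eventually (gt_mem_nhds hzR)
  have hcmp : ∀ j' (x : ℝ × ℝ), x.1 ∈ Icc s t' → x.2 < R → 0 ≤ x.2 →
      u (x.1, x.2 • e j') ≤ F j' x + M := fun j' x h1 h2 h3 => by
    have := hmax' j' x.1 x.2 ⟨mem_univ _, h1, h3, h2.le⟩
    linarith
  rcases hz.1.eq_or_lt with hz0 | hz0
  · subst hz0
    -- For `q ≤ 0` the velocity is admissible in `H_i^-`. For `q > 0` the trajectory only moves away
    -- from the junction point, which is then at distance at least `ρ` from it and excluded by the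
    -- penalty.
    rcases le_or_gt q 0 with hq | hq
    · have h1 := hu.le_of_junction he hinj hτT (hFd M) (by intro i j t; simp [hFv]) j (hF1 M τ j 0)
        (fun j => hF2 M τ j 0)
        (fun j' => by
          filter_upwards [hτev, hzev] with x h1 h2 h3
          exact hcmp j' x h1 h2 h3)
        (by rw [hM, zero_smul]; ring) i
      have h2 := mul_sub_le_hamiltonianNeg (hL i) (2 * k * α i * (α i * 0 - X τ) + β i) hq
      rw [hαi, hβi] at h1 h2
      linarith
    · have : y ≤ X τ := by
        simp only [hX]
        nlinarith
      have := hkD (α j * 0 - X τ) (by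
        rw [mul_zero, zero_sub, abs_neg]
        exact hρy.trans (this.trans (le_abs_self _)))
      linarith
  · have hzev' : ∀ᶠ x : ℝ × ℝ in 𝓝 (τ, z), 0 < x.2 :=
      (continuous_snd.tendsto (τ, z)).eventually (lt_mem_nhds hz0)
    have h1 := hu.le_of_branch he hinj hτT hz0 (hFd M j) (hF1 M τ j z) (hF2 M τ j z)
      (by
        filter_upwards [hτev, hzev, hzev'] with x h1 h2 h3
        exact hcmp j x h1 h2 h3.le)
      (by rw [hM]; ring)
    by_cases hj : j = i
    · subst hj
      have h2 := mul_sub_le_hamiltonian (hL j) (2 * k * α j * (α j * z - X τ) + β j) q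
      rw [hαi, hβi] at h1 h2
      linarith
    · have h2 := mul_sub_le_hamiltonian (hL j) (2 * k * α j * (α j * z - X τ) + β j) 1
      rw [hαj j hj, hβj j hj] at h1 h2
      have h3 : -(2 * k * (X τ * q)) ≤ 2 * k * (R * |q|) := by
        have : -(X τ * q) ≤ R * |q| := by
          calc -(X τ * q) ≤ |X τ * q| := neg_le_abs _
            _ = |X τ| * |q| := abs_mul _ _
            _ ≤ R * |q| := by
              gcongr
              linarith [hXR τ hτ]
        nlinarith
      have h4 := le_abs_self (L j 1)
      have h5 := hSj j
      have h6 := neg_abs_le A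
      linarith

/-- Suboptimality: a sub-solution grows along a trajectory with constant velocity in a branch at
most as the integral of the Lagrangian. -/
theorem IsSubsolution.le_add (hu : IsSubsolution e L T u) (he : ∀ i, ‖e i‖ = 1)
    (hinj : Function.Injective e) (hL : ∀ i p, ∃ B, ∀ q, p * q - L i q ≤ B)
    (hLc : ∀ i, Continuous (L i)) {i : Fin N} {s h y q : ℝ} (hs : 0 ≤ s) (hh : 0 < h)
    (hsh : s + h < T) (hy : 0 ≤ y) (hx : 0 ≤ y + h * q) :
    u (s + h, (y + h * q) • e i) ≤ u (s, y • e i) + h * L i q := by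
  refine le_of_forall_pos_le_add fun ε hε => ?_
  rcases hy.eq_or_lt with rfl | hy
  · have h1 := upperSemicontinuousOn_branch hu.upperSemicontinuousOn
      (⟨hs, by linarith⟩ : s ∈ Ico 0 T) i 0 self_mem_Ici (u (s, (0 : ℝ) • e i) + ε / 3)
      (by linarith)
    -- A start at the junction point is approximated by starts at `y > 0`; velocity `q - y / h`
    -- leads to the same endpoint.
    have hc : Continuous fun y => h * L i (q - y / h) := by
      have := hLc i
      fun_prop
    have h2 : ∀ᶠ y in 𝓝 (0 : ℝ), h * L i (q - y / h) < h * L i q + ε / 3 :=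
      (hc.tendsto 0).eventually (gt_mem_nhds (by simp; linarith))
    have h1' : ∀ᶠ y in 𝓝[>] (0 : ℝ), u (s, y • e i) < u (s, (0 : ℝ) • e i) + ε / 3 :=
      nhdsWithin_mono (0 : ℝ) Ioi_subset_Ici_self h1
    have h3 := h1'.and (h2.filter_mono nhdsWithin_le_nhds)
    obtain ⟨y, ⟨hy1, hy2⟩, hy0⟩ := (h3.and self_mem_nhdsWithin).exists
    have hyq : y + h * (q - y / h) = 0 + h * q := by field_simp; ring
    have := hu.le_add_of_pos he hinj hL (i := i) (q := q - y / h) hs hh hsh hy0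
      (by rw [hyq]; exact hx) (by linarith : 0 < ε / 6)
    rw [hyq] at this
    linarith
  · have := hu.le_add_of_pos he hinj hL (i := i) hs hh hsh hy hx (by linarith : 0 < ε / 2)
    linarith

end Suboptimality

end HJJunction

namespace HJJunction

open Set Filter Topology

/-! ### Comparison of a strictly suboptimal function with a super-solution. -/

section Comparison

variable {N : ℕ} {e : Fin N → Plane} {L : Fin N → ℝ → ℝ} {T : ℝ} {u v : ℝ × Plane → ℝ}

/-- Division by `x` and passage to the limit: this extracts the first-order information from
suboptimality without differentiating `w`. -/
theorem nonneg_of_forall_small {b C h₀ : ℝ} (h0 : 0 < h₀)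
    (h : ∀ x, 0 < x → x < h₀ → 0 ≤ x * b + C * x ^ 2) : 0 ≤ b := by
  have hc : Tendsto (fun x : ℝ => b + C * x) (𝓝[>] 0) (𝓝 b) := by
    have : Continuous fun x : ℝ => b + C * x := by fun_prop
    simpa using (this.tendsto 0).mono_left nhdsWithin_le_nhds
  refine ge_of_tendsto hc ?_
  filter_upwards [Ioo_mem_nhdsGT h0] with x hx
  have := h x hx.1 hx.2
  have h2 : 0 ≤ x * (b + C * x) := by linarith
  exact nonneg_of_mul_nonneg_right h2 hx.1

/-- A strictly suboptimal function minus a super-solution, with doubled time, has no maximum at the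
junction point. -/
theorem IsSupersolution.not_max_at_junction (hv : IsSupersolution e L T v)
    (he : ∀ i, ‖e i‖ = 1) (hinj : Function.Injective e) {γ : ℝ} (hγ : 0 < γ)
    (hLd : ∀ i, ContDiff ℝ 2 (L i))
    (hL : ∀ i a q, L i a + deriv (L i) a * (q - a) + γ / 2 * (q - a) ^ 2 ≤ L i q)
    {w : Fin N → ℝ → ℝ → ℝ} {η k M R t₀ t₁ s₀ T₁ : ℝ} (hη : 0 < η)
    (hw : ∀ i t h r q, 0 ≤ t → 0 < h → t + h ≤ t₁ → 0 ≤ r → 0 ≤ r + h * q →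
      w i (t + h) (r + h * q) ≤ w i t r + h * (L i q - η))
    (hw0 : ∀ i j t, w i t 0 = w j t 0)
    (hmax : ∀ i, ∀ t ∈ Icc 0 t₁, ∀ s ∈ Icc 0 T₁, ∀ r ∈ Icc 0 R,
      w i t r - v (s, r • e i) - k * (t - s) ^ 2 ≤ M) (i : Fin N)
    (heq : w i t₀ 0 - v (s₀, 0) - k * (t₀ - s₀) ^ 2 = M)
    (ht0 : 0 < t₀) (ht1 : t₀ ≤ t₁) (hs0 : 0 < s₀) (hs1 : s₀ < T₁) (hT : T₁ < T) (hR : 0 < R) :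
    False := by
  set a : ℝ := 2 * k * (t₀ - s₀) with ha
  have ha0 : ∀ j, a ≤ L j 0 - η := by
    intro j
    -- Suboptimality along the trajectory resting at the junction point until time `t₀`.
    have := nonneg_of_forall_small (b := L j 0 - η - a) (C := k) ht0 (fun h h0 h1 => by
      have h2 := hw j (t₀ - h) h 0 0 (by linarith) h0 (by linarith) le_rfl (by simp)
      have h3 := hmax j (t₀ - h) ⟨by linarith, by linarith⟩ s₀ ⟨hs0.le, hs1.le⟩ 0 ⟨le_rfl, hR.le⟩
      simp only [sub_add_cancel, mul_zero, add_zero, zero_smul] at h2 h3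
      simp only [hw0 j i] at h2 h3
      nlinarith)
    linarith
  -- Giving up half of `η` makes the level strictly larger than `-L j 0`, so that a velocity
  -- pointing strictly towards the junction point exists.
  have hex : ∀ j, ∃ q < 0, ∃ p, p * q - L j q = -a - η / 2 ∧
      ∀ q', p * q' - L j q' ≤ -a - η / 2 := fun j =>
    exists_neg_velocity hγ (hLd j) (hL j) (by have := ha0 j; linarith)
  choose q hq p hp hpq using hex
  -- `κ j * r` is the time needed to travel from `r` to the junction point with velocity `q j`. The
  -- function `f` below bounds `v (s, r)` from below by letting the trajectory leave `r` at time `t₀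
  -- - κ j * r`; its slope at `0` is exactly `p j`.
  set κ : Fin N → ℝ := fun j => -(q j)⁻¹ with hκ
  have hκ0 : ∀ j, 0 < κ j := fun j => neg_pos.2 (inv_lt_zero.2 (hq j))
  have hκq : ∀ j, κ j * q j = -1 := fun j => by
    simp only [hκ]
    rw [neg_mul, inv_mul_cancel₀ (hq j).ne]
  set ℓ : Fin N → ℝ := fun j => L j (q j) - η / 2 with hℓ
  set f : Fin N → ℝ × ℝ → ℝ := fun j z =>
    w i t₀ 0 - κ j * z.2 * ℓ j - k * (t₀ - κ j * z.2 - z.1) ^ 2 - M with hf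
  have hfd : ∀ j, ContDiff ℝ 1 (f j) := by
    intro j
    simp only [hf]
    fun_prop
  have hf1 : HasDerivAt (fun s => f i (s, 0)) a s₀ := by
    simp only [hf]
    have := (((((hasDerivAt_id s₀).const_sub (t₀ - κ i * 0)).pow 2).const_mul k).const_sub
      (w i t₀ 0 - κ i * 0 * ℓ i)).sub_const M
    refine this.congr_deriv ?_
    simp
    ring
  have hf2 : ∀ j, HasDerivAt (fun r => f j (s₀, r)) (p j) 0 := by
    intro j
    simp only [hf]
    have h1 := (((hasDerivAt_id (0 : ℝ)).const_mul (κ j)).mul_const (ℓ j)).const_sub (w i t₀ 0)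
    have h2 := ((((((hasDerivAt_id (0 : ℝ)).const_mul (κ j)).const_sub t₀).sub_const s₀).pow 2
      ).const_mul k)
    refine ((h1.sub h2).sub_const M).congr_deriv ?_
    have h3 : p j * q j = ℓ j - a := by
      have := hp j
      simp only [hℓ]
      linarith
    have h4 : p j = κ j * (a - ℓ j) := by
      have := hκq j
      calc p j = -(κ j * q j) * p j := by rw [this]; ring
        _ = -κ j * (p j * q j) := by ring
        _ = _ := by rw [h3]; ring
    rw [h4, ha]
    simp
    ring
  have key := hv.ge_of_junction he hinj (t := s₀) ⟨hs0, hs1.trans hT⟩ hfd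
    (by intro i j t; simp [hf]) i hf1 hf2 (fun j => by
      have h1 : ∀ᶠ z : ℝ × ℝ in 𝓝 (s₀, 0), z.1 ∈ Icc 0 T₁ :=
        (continuous_fst.tendsto (s₀, (0 : ℝ))).eventually (Icc_mem_nhds hs0 hs1)
      have h2 : ∀ᶠ z : ℝ × ℝ in 𝓝 (s₀, 0), z.2 < R :=
        (continuous_snd.tendsto (s₀, (0 : ℝ))).eventually (gt_mem_nhds hR)
      have h3 : ∀ᶠ z : ℝ × ℝ in 𝓝 (s₀, 0), κ j * z.2 < t₀ := by
        have : Continuous fun z : ℝ × ℝ => κ j * z.2 := by fun_prop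
        exact (this.tendsto (s₀, (0 : ℝ))).eventually (gt_mem_nhds (by simpa using ht0))
      filter_upwards [h1, h2, h3] with z h1 h2 h3 h4
      obtain ⟨s, r⟩ := z
      simp only at h1 h2 h3 h4
      simp only [hf]
      have h5 := hmax j (t₀ - κ j * r) ⟨by linarith, by nlinarith [hκ0 j]⟩ s h1 r ⟨h4, h2.le⟩
      rcases h4.eq_or_lt with rfl | h4'
      · simp only [mul_zero, sub_zero, zero_mul] at h5 ⊢
        rw [hw0 j i] at h5
        linarith
      · have h6 : 0 < κ j * r := mul_pos (hκ0 j) h4'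
        have h7 : r + κ j * r * q j = 0 := by
          have := hκq j
          calc r + κ j * r * q j = r * (1 + κ j * q j) := by ring
            _ = 0 := by rw [this]; ring
        have h8 := hw j (t₀ - κ j * r) (κ j * r) r (q j) (by linarith) h6 (by linarith) h4
          h7.symm.le
        rw [h7, sub_add_cancel, hw0 j i] at h8
        have h9 : κ j * r * (L j (q j) - η) ≤ κ j * r * ℓ j := by
          gcongr
          simp only [hℓ]
          linarith
        linarith)
    (by simp only [hf]; simp only [mul_zero, sub_zero, zero_mul]; linarith)
  have : Nonempty (Fin N) := ⟨i⟩
  have hsup : ⨆ j, hamiltonianNeg (L j) (p j) ≤ -a - η / 2 :=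
    ciSup_le fun j => hamiltonianNeg_le fun q' _ => hpq j q'
  linarith

/-- A strictly suboptimal function minus a super-solution, with doubled variables, has no maximum
in the interior of a branch. -/
theorem IsSupersolution.not_max_in_branch (hv : IsSupersolution e L T v)
    (he : ∀ i, ‖e i‖ = 1) (hinj : Function.Injective e) {i : Fin N}
    {w : ℝ → ℝ → ℝ} {η k n M R t₀ t₁ s₀ T₁ x₀ y₀ : ℝ} (hη : 0 < η)
    (hw : ∀ t h r q, 0 ≤ t → 0 < h → t + h ≤ t₁ → 0 ≤ r → 0 ≤ r + h * q →
      w (t + h) (r + h * q) ≤ w t r + h * (L i q - η))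
    (hmax : ∀ t ∈ Icc 0 t₁, ∀ s ∈ Icc 0 T₁, ∀ x ∈ Icc 0 R, ∀ y ∈ Icc 0 R,
      w t x - v (s, y • e i) - k * (t - s) ^ 2 - n * (x - y) ^ 2 ≤ M)
    (heq : w t₀ x₀ - v (s₀, y₀ • e i) - k * (t₀ - s₀) ^ 2 - n * (x₀ - y₀) ^ 2 = M)
    (ht0 : 0 < t₀) (ht1 : t₀ ≤ t₁) (hs0 : 0 < s₀) (hs1 : s₀ < T₁) (hT : T₁ < T)
    (hx0 : 0 < x₀) (hxR : x₀ < R) (hy0 : 0 < y₀) (hyR : y₀ < R) : False := by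
  set a : ℝ := 2 * k * (t₀ - s₀) with ha
  set p : ℝ := 2 * n * (x₀ - y₀) with hp
  -- Arriving at `(t₀, x₀)` with an arbitrary velocity `q` and comparing with the maximum yields `a
  -- + H_i(p) ≤ -η`; the test function for `v` then gives `a + H_i(p) ≥ 0`.
  have hq : ∀ q, p * q - L i q ≤ -a - η := by
    intro q
    obtain ⟨δ, hδ0, hδ⟩ : ∃ δ > 0, ∀ h, 0 < h → h < δ → x₀ - h * q ∈ Icc 0 R := by
      have hc : Continuous fun h : ℝ => x₀ - h * q := by fun_prop
      have := (hc.tendsto 0).eventually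
        (Icc_mem_nhds (a := 0) (b := R) (by simpa using hx0) (by simpa using hxR))
      obtain ⟨δ, hδ0, hδ⟩ := Metric.eventually_nhds_iff.1 this
      exact ⟨δ, hδ0, fun h h0 h1 => hδ (by rwa [Real.dist_eq, sub_zero, abs_of_pos h0])⟩
    have := nonneg_of_forall_small (b := L i q - η - a - p * q) (C := k + n * q ^ 2)
      (lt_min ht0 hδ0) (fun h h0 h1 => by
        have hx := hδ h h0 (h1.trans_le (min_le_right _ _))
        have ht := h1.trans_le (min_le_left _ _)
        have h2 := hw (t₀ - h) h (x₀ - h * q) q (by linarith) h0 (by linarith) hx.1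
          (by linarith)
        have h3 := hmax (t₀ - h) ⟨by linarith, by linarith⟩ s₀ ⟨hs0.le, hs1.le⟩ _ hx y₀
          ⟨hy0.le, hyR.le⟩
        simp only [sub_add_cancel] at h2
        have e1 : k * (t₀ - h - s₀) ^ 2 = k * (t₀ - s₀) ^ 2 - a * h + k * h ^ 2 := by
          rw [ha]; ring
        have e2 : n * (x₀ - h * q - y₀) ^ 2
            = n * (x₀ - y₀) ^ 2 - p * q * h + n * q ^ 2 * h ^ 2 := by
          rw [hp]; ring
        rw [e1, e2] at h3
        linarith)
    linarith
  set f : ℝ × ℝ → ℝ := fun z =>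
    w t₀ x₀ - k * (t₀ - z.1) ^ 2 - n * (x₀ - z.2) ^ 2 - M with hf
  have hfd : ContDiff ℝ 1 f := by
    simp only [hf]
    fun_prop
  have hf1 : HasDerivAt (fun s => f (s, y₀)) a s₀ := by
    simp only [hf]
    have := ((((((hasDerivAt_id s₀).const_sub t₀).pow 2).const_mul k).const_sub
      (w t₀ x₀)).sub_const (n * (x₀ - y₀) ^ 2)).sub_const M
    refine this.congr_deriv ?_
    simp
    ring
  have hf2 : HasDerivAt (fun r => f (s₀, r)) p y₀ := by
    simp only [hf]
    have := (((((hasDerivAt_id y₀).const_sub x₀).pow 2).const_mul n).const_sub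
      (w t₀ x₀ - k * (t₀ - s₀) ^ 2)).sub_const M
    refine this.congr_deriv ?_
    simp
    ring
  have h1 : ∀ᶠ z : ℝ × ℝ in 𝓝 (s₀, y₀), z.1 ∈ Icc 0 T₁ :=
    (continuous_fst.tendsto (s₀, y₀)).eventually (Icc_mem_nhds hs0 hs1)
  have h2 : ∀ᶠ z : ℝ × ℝ in 𝓝 (s₀, y₀), z.2 ∈ Icc 0 R :=
    (continuous_snd.tendsto (s₀, y₀)).eventually (Icc_mem_nhds hy0 hyR)
  have key := hv.ge_of_branch he hinj (t := s₀) ⟨hs0, hs1.trans hT⟩ hy0 hfd hf1 hf2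
    (by
      filter_upwards [h1, h2] with z h1 h2
      have := hmax t₀ ⟨ht0.le, ht1⟩ z.1 h1 x₀ ⟨hx0.le, hxR.le⟩ z.2 h2
      simp only [hf]
      linarith)
    (by simp only [hf]; linarith)
  have := hamiltonian_le hq
  linarith

/-- Comparison of a strictly suboptimal function, below the super-solution at the initial time and
far from the junction point, with a super-solution. -/
theorem IsSupersolution.le_of_suboptimal (hv : IsSupersolution e L T v)
    (he : ∀ i, ‖e i‖ = 1) (hinj : Function.Injective e) {γ : ℝ} (hγ : 0 < γ)
    (hLd : ∀ i, ContDiff ℝ 2 (L i))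
    (hL : ∀ i a q, L i a + deriv (L i) a * (q - a) + γ / 2 * (q - a) ^ 2 ≤ L i q)
    {w : Fin N → ℝ → ℝ → ℝ} {η R t₁ : ℝ} (hη : 0 < η) (ht0 : 0 < t₁) (ht1 : t₁ < T)
    (husc : UpperSemicontinuousOn (fun z : Fin N × ℝ × ℝ => w z.1 z.2.1 z.2.2)
      (univ ×ˢ Ico 0 T ×ˢ Ici 0))
    (hw : ∀ i t h r q, 0 ≤ t → 0 < h → t + h ≤ t₁ → 0 ≤ r → 0 ≤ r + h * q →
      w i (t + h) (r + h * q) ≤ w i t r + h * (L i q - η))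
    (hw0 : ∀ i j t, w i t 0 = w j t 0)
    (hinit : ∀ i r, 0 ≤ r → w i 0 r ≤ v (0, r • e i))
    (hfar : ∀ i, ∀ t ∈ Icc 0 t₁, ∀ r, R ≤ r → 0 ≤ r → w i t r ≤ v (t, r • e i))
    (i : Fin N) {x : ℝ} (hx : 0 ≤ x) : w i t₁ x ≤ v (t₁, x • e i) := by
  by_contra! hcon
  set m : ℝ := w i t₁ x - v (t₁, x • e i) with hm
  have hm0 : 0 < m := by simp only [hm]; linarith
  have hxR : x < R := by
    by_contra! h
    exact absurd (hfar i t₁ ⟨ht0.le, le_rfl⟩ x h hx) (by linarith)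
  have hR0 : 0 < R := hx.trans_lt hxR
  -- The variable `s` ranges beyond `t₁`, so near-diagonal maxima satisfy `s < T₁`. The value `t =
  -- t₁` is harmless, since `w` is only examined along trajectories from the past.
  obtain ⟨T₁, hT1, hT2⟩ := exists_between ht1
  have hvusc : UpperSemicontinuousOn (fun z : Fin N × ℝ × ℝ => -v (z.2.1, z.2.2 • e z.1))
      (univ ×ˢ Ico 0 T ×ˢ Ici 0) := by
    have : LowerSemicontinuousOn (fun z : Fin N × ℝ × ℝ => v (z.2.1, z.2.2 • e z.1))
        (univ ×ˢ Ico 0 T ×ˢ Ici 0) :=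
      hv.lowerSemicontinuousOn.comp (continuous_coordinates e).continuousOn
        fun _ hz => ⟨hz.2.1, smul_mem_junction _ hz.2.2⟩
    intro z hz y hy
    have hy' : -v (z.2.1, z.2.2 • e z.1) < y := hy
    filter_upwards [this z hz (-y) (neg_lt.1 hy')] with z' hz'
    exact neg_lt.2 hz'
  -- doubling of the time variable
  set K : Set (Fin N × ℝ × ℝ × ℝ) := univ ×ˢ Icc 0 t₁ ×ˢ Icc 0 T₁ ×ˢ Icc 0 R with hK
  have hKc : IsCompact K :=
    isCompact_univ.prod (isCompact_Icc.prod (isCompact_Icc.prod isCompact_Icc))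
  set f : Fin N × ℝ × ℝ × ℝ → ℝ :=
    fun z => w z.1 z.2.1 z.2.2.2 + -v (z.2.2.1, z.2.2.2 • e z.1) with hf
  have hfusc : UpperSemicontinuousOn f K := by
    refine UpperSemicontinuousOn.add ?_ ?_
    · exact husc.comp (g := fun z : Fin N × ℝ × ℝ × ℝ => (z.1, z.2.1, z.2.2.2))
        (Continuous.continuousOn (by fun_prop))
        fun z hz => ⟨mem_univ _, ⟨hz.2.1.1, hz.2.1.2.trans_lt ht1⟩, hz.2.2.2.1⟩
    · exact hvusc.comp (g := fun z : Fin N × ℝ × ℝ × ℝ => (z.1, z.2.2.1, z.2.2.2))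
        (Continuous.continuousOn (by fun_prop))
        fun z hz => ⟨mem_univ _, ⟨hz.2.2.1.1, hz.2.2.1.2.trans_lt hT2⟩, hz.2.2.2.1⟩
  have hU : IsOpen {z : Fin N × ℝ × ℝ × ℝ |
      0 < z.2.1 ∧ 0 < z.2.2.1 ∧ z.2.2.1 < T₁ ∧ z.2.2.2 < R} := by
    refine (isOpen_lt ?_ ?_).and ((isOpen_lt ?_ ?_).and ((isOpen_lt ?_ ?_).and
      (isOpen_lt ?_ ?_))) <;> fun_prop
  obtain ⟨k, hk⟩ := (eventually_forall_mem_of_penalized (m := m)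
    (g := fun z => (z.2.1 - z.2.2.1) ^ 2) hKc hU hfusc (by fun_prop) (fun z => sq_nonneg _)
    (by
      rintro ⟨j, t, s, r⟩ ⟨-, ht, hs, hr⟩ hts hmf
      simp only at ht hs hr hts
      have hts' : t = s := by
        have := pow_eq_zero_iff (two_ne_zero) |>.1 hts
        linarith
      subst hts'
      have hmf' : m ≤ w j t r + -v (t, r • e j) := hmf
      have htpos : 0 < t := by
        refine lt_of_le_of_ne ht.1 ?_
        rintro rfl
        have := hinit j r hr.1
        linarith
      refine ⟨htpos, htpos, ht.2.trans_lt hT1, ?_⟩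
      by_contra! hc
      have := hfar j t ht r hc hr.1
      linarith)).exists
  have hFusc : UpperSemicontinuousOn
      (fun z => f z + -((k : ℝ) * (z.2.1 - z.2.2.1) ^ 2)) K :=
    hfusc.add (Continuous.continuousOn (by fun_prop)).upperSemicontinuousOn
  have hP : (i, t₁, t₁, x) ∈ K :=
    ⟨mem_univ _, ⟨ht0.le, le_rfl⟩, ⟨ht0.le, hT1.le⟩, ⟨hx, hxR.le⟩⟩
  obtain ⟨⟨i₀, t₀, s₀, r₀⟩, hz₀, hmax₀⟩ := hFusc.exists_isMaxOn ⟨_, hP⟩ hKc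
  set M : ℝ := w i₀ t₀ r₀ - v (s₀, r₀ • e i₀) - k * (t₀ - s₀) ^ 2 with hM
  have hmax : ∀ j, ∀ t ∈ Icc 0 t₁, ∀ s ∈ Icc 0 T₁, ∀ r ∈ Icc 0 R,
      w j t r - v (s, r • e j) - k * (t - s) ^ 2 ≤ M := by
    intro j t ht s hs r hr
    have : w j t r + -v (s, r • e j) + -(k * (t - s) ^ 2) ≤
        w i₀ t₀ r₀ + -v (s₀, r₀ • e i₀) + -(k * (t₀ - s₀) ^ 2) :=
      hmax₀ (a := (j, t, s, r)) ⟨mem_univ _, ht, hs, hr⟩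
    linarith
  have hmM : m ≤ M := by
    have := hmax i t₁ ⟨ht0.le, le_rfl⟩ t₁ ⟨ht0.le, hT1.le⟩ x ⟨hx, hxR.le⟩
    rw [sub_self] at this
    linarith
  -- Every maximum point, not only the selected one, must be interior: the space penalization with
  -- `k` fixed uses this for all diagonal points at level `M`.
  have hgood : ∀ j, ∀ t ∈ Icc 0 t₁, ∀ s ∈ Icc 0 T₁, ∀ r ∈ Icc 0 R,
      M ≤ w j t r - v (s, r • e j) - k * (t - s) ^ 2 →
      0 < t ∧ 0 < s ∧ s < T₁ ∧ 0 < r ∧ r < R := by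
    intro j t ht s hs r hr hle
    obtain ⟨h1, h2, h3, h4⟩ : 0 < t ∧ 0 < s ∧ s < T₁ ∧ r < R :=
      hk (j, t, s, r) ⟨mem_univ _, ht, hs, hr⟩ (by
        change m ≤ w j t r + -v (s, r • e j) - k * (t - s) ^ 2
        linarith)
    refine ⟨h1, h2, h3, lt_of_le_of_ne hr.1 ?_, h4⟩
    rintro rfl
    have heq := le_antisymm (hmax j t ht s hs 0 hr) hle
    rw [zero_smul] at heq
    exact hv.not_max_at_junction he hinj hγ hLd hL hη hw hw0 hmax j heq h1 ht.2 h2 h3 hT2 hR0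
  -- doubling of the space variable
  set K' : Set (ℝ × ℝ × ℝ × ℝ) := Icc 0 t₁ ×ˢ Icc 0 T₁ ×ˢ Icc 0 R ×ˢ Icc 0 R with hK'
  have hKc' : IsCompact K' :=
    isCompact_Icc.prod (isCompact_Icc.prod (isCompact_Icc.prod isCompact_Icc))
  set f' : ℝ × ℝ × ℝ × ℝ → ℝ := fun z =>
    w i₀ z.1 z.2.2.1 + -v (z.2.1, z.2.2.2 • e i₀) + -(k * (z.1 - z.2.1) ^ 2) with hf'
  have hfusc' : UpperSemicontinuousOn f' K' := by
    refine UpperSemicontinuousOn.add (UpperSemicontinuousOn.add ?_ ?_)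
      (Continuous.continuousOn (by fun_prop)).upperSemicontinuousOn
    · exact husc.comp (g := fun z : ℝ × ℝ × ℝ × ℝ => (i₀, z.1, z.2.2.1))
        (Continuous.continuousOn (by fun_prop))
        fun z hz => ⟨mem_univ _, ⟨hz.1.1, hz.1.2.trans_lt ht1⟩, hz.2.2.1.1⟩
    · exact hvusc.comp (g := fun z : ℝ × ℝ × ℝ × ℝ => (i₀, z.2.1, z.2.2.2))
        (Continuous.continuousOn (by fun_prop))
        fun z hz => ⟨mem_univ _, ⟨hz.2.1.1, hz.2.1.2.trans_lt hT2⟩, hz.2.2.2.1⟩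
  have hU' : IsOpen {z : ℝ × ℝ × ℝ × ℝ | 0 < z.1 ∧ 0 < z.2.1 ∧ z.2.1 < T₁ ∧
      0 < z.2.2.1 ∧ z.2.2.1 < R ∧ 0 < z.2.2.2 ∧ z.2.2.2 < R} := by
    refine (isOpen_lt ?_ ?_).and ((isOpen_lt ?_ ?_).and ((isOpen_lt ?_ ?_).and
      ((isOpen_lt ?_ ?_).and ((isOpen_lt ?_ ?_).and ((isOpen_lt ?_ ?_).and
      (isOpen_lt ?_ ?_)))))) <;> fun_prop
  obtain ⟨n, hn⟩ := (eventually_forall_mem_of_penalized (m := M)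
    (g := fun z => (z.2.2.1 - z.2.2.2) ^ 2) hKc' hU' hfusc' (by fun_prop) (fun z => sq_nonneg _)
    (by
      rintro ⟨t, s, x, y⟩ ⟨ht, hs, hx, hy⟩ hxy hmf
      simp only at ht hs hx hy hxy
      have hxy' : x = y := by
        have := pow_eq_zero_iff (two_ne_zero) |>.1 hxy
        linarith
      subst hxy'
      have hmf' : M ≤ w i₀ t x + -v (s, x • e i₀) + -(k * (t - s) ^ 2) := hmf
      obtain ⟨h1, h2, h3, h4, h5⟩ := hgood i₀ t ht s hs x hx (by linarith)
      exact ⟨h1, h2, h3, h4, h5, h4, h5⟩)).exists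
  have hFusc' : UpperSemicontinuousOn
      (fun z => f' z + -((n : ℝ) * (z.2.2.1 - z.2.2.2) ^ 2)) K' :=
    hfusc'.add (Continuous.continuousOn (by fun_prop)).upperSemicontinuousOn
  have hP' : (t₀, s₀, r₀, r₀) ∈ K' := ⟨hz₀.2.1, hz₀.2.2.1, hz₀.2.2.2, hz₀.2.2.2⟩
  obtain ⟨⟨t, s, x', y⟩, hz, hmax'⟩ := hFusc'.exists_isMaxOn ⟨_, hP'⟩ hKc'
  set M' : ℝ := w i₀ t x' - v (s, y • e i₀) - k * (t - s) ^ 2 - n * (x' - y) ^ 2 with hM'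
  have hmax'' : ∀ t ∈ Icc 0 t₁, ∀ s ∈ Icc 0 T₁, ∀ x ∈ Icc 0 R, ∀ y ∈ Icc 0 R,
      w i₀ t x - v (s, y • e i₀) - k * (t - s) ^ 2 - n * (x - y) ^ 2 ≤ M' := by
    intro t₂ ht s₂ hs x₂ hx y₂ hy
    have : w i₀ t₂ x₂ + -v (s₂, y₂ • e i₀) + -(k * (t₂ - s₂) ^ 2) + -(n * (x₂ - y₂) ^ 2) ≤
        w i₀ t x' + -v (s, y • e i₀) + -(k * (t - s) ^ 2) + -(n * (x' - y) ^ 2) :=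
      hmax' (a := (t₂, s₂, x₂, y₂)) ⟨ht, hs, hx, hy⟩
    linarith
  have hMM' : M ≤ M' := by
    have := hmax'' t₀ hz₀.2.1 s₀ hz₀.2.2.1 r₀ hz₀.2.2.2 r₀ hz₀.2.2.2
    rw [sub_self r₀] at this
    linarith
  obtain ⟨h1, h2, h3, h4, h5, h6, h7⟩ :
      0 < t ∧ 0 < s ∧ s < T₁ ∧ 0 < x' ∧ x' < R ∧ 0 < y ∧ y < R :=
    hn (t, s, x', y) hz (by
      change M ≤ w i₀ t x' + -v (s, y • e i₀) + -(k * (t - s) ^ 2) - n * (x' - y) ^ 2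
      linarith)
  exact hv.not_max_in_branch he hinj hη (hw i₀) hmax'' rfl h1 hz.1.2 h2 h3 hT2 h4 h5 h6 h7

end Comparison

end HJJunction

/-! ### The comparison principle. -/

theorem theorem1p2
    (N : ℕ) (hN : 1 ≤ N)
    (e : Fin N → HJJunction.Plane) (he_unit : ∀ i, ‖e i‖ = 1) (he_inj : Function.Injective e)
    (u₀ : HJJunction.Plane → ℝ) (hu₀ : ∃ K, LipschitzOnWith K u₀ (HJJunction.junction e))
    (L : Fin N → ℝ → ℝ) (hL : ∀ i, ContDiff ℝ 2 (L i))
    (hL_convex : ∃ γ : ℝ, 0 < γ ∧ ∀ i, ∀ q : ℝ, γ ≤ iteratedDeriv 2 (L i) q)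
    (T : ℝ) (hT : 0 < T)
    (u v : ℝ × HJJunction.Plane → ℝ)
    (hu : HJJunction.IsCauchySubsolution e L T u₀ u)
    (hv : HJJunction.IsCauchySupersolution e L T u₀ v)
    (hu_growth : ∃ C : ℝ, 0 < C ∧
      ∀ t ∈ Set.Ioo 0 T, ∀ x ∈ HJJunction.junction e, u (t, x) ≤ C * (1 + ‖x‖))
    (hv_growth : ∃ C : ℝ, 0 < C ∧
      ∀ t ∈ Set.Ioo 0 T, ∀ x ∈ HJJunction.junction e, -C * (1 + ‖x‖) ≤ v (t, x)) :
    ∀ t ∈ Set.Ioo 0 T, ∀ x ∈ HJJunction.junction e, u (t, x) ≤ v (t, x) := by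
  open HJJunction Set in
  obtain ⟨γ, hγ, hγL⟩ := hL_convex
  have hLq := fun i => quadratic_lower_bound (hL i) (hγL i)
  have hLb : ∀ i p, ∃ B, ∀ q, p * q - L i q ≤ B := fun i => exists_forall_mul_sub_le hγ (hLq i)
  -- The linear lower bound is extended to `t = 0`, where it follows from `v ≥ u₀` and the Lipschitz
  -- bound on `u₀`.
  obtain ⟨C, hC, hvC⟩ : ∃ C : ℝ, 0 < C ∧ ∀ t ∈ Ico 0 T, ∀ i, ∀ r, 0 ≤ r →
      -C * (1 + r) ≤ v (t, r • e i) := by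
    obtain ⟨C₁, hC₁, hv₁⟩ := hv_growth
    obtain ⟨K, hK⟩ := hu₀
    set C₂ : ℝ := max C₁ (max |u₀ 0| K) with hC₂
    refine ⟨C₂, lt_max_of_lt_left hC₁, fun t ht i r hr => ?_⟩
    have hJ : r • e i ∈ junction e := smul_mem_junction i hr
    have h1r : 0 ≤ 1 + r := by linarith
    rcases ht.1.eq_or_lt with rfl | ht0
    · have h1 := hv.initial_ge _ hJ
      have h2 := hK.dist_le_mul _ hJ 0 (by simpa using smul_mem_junction (e := e) i le_rfl)
      rw [dist_zero_right, norm_smul_branch he_unit i hr, Real.dist_eq] at h2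
      have h3 : |u₀ 0| ≤ C₂ := (le_max_left _ _).trans (le_max_right _ _)
      have h4 : (K : ℝ) * r ≤ C₂ * r := by
        gcongr
        exact (le_max_right _ _).trans (le_max_right _ _)
      have h5 := neg_abs_le (u₀ (r • e i) - u₀ 0)
      have h6 := neg_abs_le (u₀ 0)
      linarith
    · have h1 := hv₁ t ⟨ht0, ht.2⟩ _ hJ
      rw [norm_smul_branch he_unit i hr] at h1
      have : C₁ * (1 + r) ≤ C₂ * (1 + r) := by
        gcongr
        exact le_max_left _ _
      linarith
  intro t₁ ht₁ x hx
  obtain ⟨i, r, hr, rfl⟩ := exists_of_mem_junction hx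
  -- `A` bounds the conjugates at slope `-(C + 1)`, which makes `B - (C + 1) * y - A * t` suboptimal
  -- on every branch.
  obtain ⟨A, hA⟩ : ∃ A, ∀ j q, -(C + 1) * q - L j q ≤ A := by
    choose B hB using fun j => hLb j (-(C + 1))
    obtain ⟨A, hA⟩ := (Set.finite_range B).bddAbove
    exact ⟨A, fun j q => (hB j q).trans (hA ⟨j, rfl⟩)⟩
  refine le_of_forall_pos_le_add fun ε hε => ?_
  set η : ℝ := ε / t₁ with hη
  have hη0 : 0 < η := div_pos hε ht₁.1
  -- With this `B` the affine cap equals `u` at the point of interest, so taking the minimum loses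
  -- nothing there. The slope `C + 1` pushes the cap below `-C * (1 + y)`, hence below `v`, once `y
  -- ≥ B + |A| * t₁ + C`.
  set B : ℝ := u (t₁, r • e i) + (C + 1) * r + A * t₁ with hB
  set w : Fin N → ℝ → ℝ → ℝ := fun j t y =>
    min (u (t, y • e j)) (B - (C + 1) * y - A * t) - η * t with hw
  have key := hv.le_of_suboptimal he_unit he_inj hγ hL hLq (w := w) (η := η)
    (R := B + |A| * t₁ + C) hη0 ht₁.1 ht₁.2
    (by
      have h1 := (upperSemicontinuousOn_coordinates hu.upperSemicontinuousOn).inf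
        (g := fun z : Fin N × ℝ × ℝ => B - (C + 1) * z.2.2 - A * z.2.1)
        (Continuous.continuousOn (by fun_prop)).upperSemicontinuousOn
      exact h1.add (g := fun z : Fin N × ℝ × ℝ => -(η * z.2.1))
        (Continuous.continuousOn (by fun_prop)).upperSemicontinuousOn)
    (by
      intro j t h y q ht hh hth hy hyq
      have h1 := hu.le_add he_unit he_inj hLb (fun j => (hL j).continuous) (i := j) ht hh
        (lt_of_le_of_lt hth ht₁.2) hy hyq
      have h2 : h * (-(C + 1) * q - L j q) ≤ h * A := by gcongr; exact hA j q
      simp only [hw]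
      have h3 : min (u (t + h, (y + h * q) • e j)) (B - (C + 1) * (y + h * q) - A * (t + h)) ≤
          min (u (t, y • e j)) (B - (C + 1) * y - A * t) + h * L j q := by
        rw [← min_add_add_right]
        refine min_le_min h1 ?_
        linarith
      linarith)
    (by intro i j t; simp only [hw, zero_smul])
    (by
      intro j y hy
      have h1 := hu.initial_le _ (smul_mem_junction (e := e) j hy)
      have h2 := hv.initial_ge _ (smul_mem_junction (e := e) j hy)
      have h3 := min_le_left (u (0, y • e j)) (B - (C + 1) * y - A * 0)
      simp only [hw]
      linarith)
    (by
      intro j t ht y hyR hy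
      have h1 := hvC t ⟨ht.1, ht.2.trans_lt ht₁.2⟩ j y hy
      have h3 := min_le_right (u (t, y • e j)) (B - (C + 1) * y - A * t)
      have h4 : 0 ≤ η * t := mul_nonneg hη0.le ht.1
      have h5 : -(A * t) ≤ |A| * t₁ := by
        calc -(A * t) ≤ |A * t| := neg_le_abs _
          _ = |A| * t := by rw [abs_mul, abs_of_nonneg ht.1]
          _ ≤ _ := by gcongr; exact ht.2
      simp only [hw]
      linarith)
    i hr
  have h1 : min (u (t₁, r • e i)) (B - (C + 1) * r - A * t₁) = u (t₁, r • e i) :=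
    min_eq_left (by rw [hB]; linarith)
  have h2 : η * t₁ = ε := div_mul_cancel₀ _ ht₁.1.ne'
  simp only [hw, h1, h2] at key
  linarith
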